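/- Let $G$ be a group and let $A \le G$ be a subgroup. Suppose that $G$ splits over $A$, that is, either (i) $G$ is a nontrivial amalgamated free product $G = G_1 *_A G_2$, where $G_1, G_2 \le G$ are subgroups containing $A$ with $A \neq G_1$ and $A \neq G_2$; or (ii) $G$ is an HNN-extension $G = K *_A = \langle K, t \mid t a t^{-1} = \varphi(a)\ (a \in A)\rangle$, where $K \le G$ is a subgroup containing $A$ and $\varphi \colon A \to B$ is an isomorphism onto a subgroup $B \le K$. Then $G$ is not $\omega$-stable. Here $G$ is called $\omega$-stable if its complete first-order theory $\mathrm{Th}(G)$ in the language of groups is $\omega$-stable: for every model $M \models \mathrm{Th}(G)$ and every countable set $X \subseteq M$, the set $S_1^M(X)$ of complete $1$-types over $X$ is countable. -/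

import Mathlib

open scoped FirstOrder

universe u v w

/-- Function symbols of the language of groups: multiplication, inverse, identity. -/
inductive GroupFunc : ℕ → Type
  | mul : GroupFunc 2
  | inv : GroupFunc 1
  | one : GroupFunc 0

/-- The first-order language of groups `(·, ⁻¹, 1)`; equality is built into the logic. -/
def groupLanguage : FirstOrder.Language.{0, 0} where
  Functions := GroupFunc
  Relations := fun _ => Empty

/-- Every group is a structure for the language of groups in the obvious way. -/
instance groupStructure (G : Type u) [Group G] : groupLanguage.Structure G where
  funMap := fun f x =>
    match f with
    | GroupFunc.mul => x 0 * x 1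
    | GroupFunc.inv => (x 0)⁻¹
    | GroupFunc.one => 1
  RelMap := fun r _ => r.elim

/-- The space `S₁(A)` of complete 1-types over a set `A` of parameters of the structure `M`: the
complete types in one variable over the theory of `M` in the language with constants for `A`. -/
abbrev OneTypes (L : FirstOrder.Language.{v, w}) (M : Type u) [L.Structure M] (A : Set M) :=
  (L[[A]].completeTheory M).CompleteType (Fin 1)

/-- A theory `T` (in a countable language) is ω-stable: over every countable set of parameters in
every model of `T` there are only countably many complete 1-types. Models are taken in an
arbitrary universe `u`; since every model in which `A` lives has a countable elementary submodel
containing `A`, the choice of `u` is immaterial. -/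
def OmegaStableTheory {L : FirstOrder.Language.{v, w}} (T : L.Theory) : Prop :=
  ∀ (M : Type u) [L.Structure M] [Nonempty M] [M ⊨ T] (A : Set M),
    A.Countable → Countable (OneTypes L M A)

/-- A group is ω-stable if its complete theory in the language of groups is. -/
def OmegaStableGroup (G : Type u) [Group G] : Prop :=
  OmegaStableTheory.{u} (groupLanguage.completeTheory G)

/-- `G = G₁ *_A G₂` nontrivially: there are subgroups `G₁, G₂` of `G`, both properly containing
`A`, such that the inclusions induce an isomorphism from the amalgamated free product of `G₁` and
`G₂` over `A` onto `G`. -/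
def IsNontrivialAmalgamOver {G : Type u} [Group G] (A : Subgroup G) : Prop :=
  ∃ (H : Fin 2 → Subgroup G) (hA : ∀ i, A < H i)
    (e : Monoid.PushoutI (fun i => Subgroup.inclusion (hA i).le) ≃* G),
    ∀ (i : Fin 2) (x : H i), e (Monoid.PushoutI.of i x) = (x : G)

/-- `G = K *_A`: there are a subgroup `K` of `G` containing `A`, a subgroup `B` of `K` and an
isomorphism `φ : A ≃ B` such that the inclusion of `K` extends to an isomorphism from the
HNN-extension `⟨K, t | t a t⁻¹ = φ a (a ∈ A)⟩` onto `G`. -/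
def IsHNNExtensionOver {G : Type u} [Group G] (A : Subgroup G) : Prop :=
  ∃ (K : Subgroup G) (_ : A ≤ K) (B : Subgroup K) (φ : A.subgroupOf K ≃* B)
    (e : HNNExtension K (A.subgroupOf K) B φ ≃* G),
    ∀ x : K, e (HNNExtension.of x) = (x : G)

/-- `G` splits over its subgroup `A`. -/
def SplitsOver {G : Type u} [Group G] (A : Subgroup G) : Prop :=
  IsNontrivialAmalgamOver A ∨ IsHNNExtensionOver A

/-! Seek `g` such that `g ^ a * y ^ 2 ^ n = g ^ b * z ^ 2 ^ n`, with `y`, `z` centralizing `g`,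
forces `a ≡ b` mod `2 ^ n`. The sets `g ^ a * C(g) ^ 2 ^ n` are definable over `g`; following the
truncations of a 2-adic integer they are finitely consistent, and distinct 2-adic integers lead to
disjoint sets. So there are uncountably many types over `{g}` (`not_omegaStableGroup_of_commute`).
In an HNN-extension take the stable letter and compare exponent sums. In an amalgam take `g = x * y`
with `x`, `y` outside `A` in the two factors: by normal forms, `C(g)` lies in `⟨g⟩A`
(`exists_zpow_mul_mem_of_commute`) and no nontrivial power of `g` lies in `A`
(`eq_zero_of_zpow_mem`). -/

open FirstOrder Language in
/-- A family of pairwise inconsistent, finitely realized sequences of formulas over `A` injects into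
the space of complete 1-types over `A`. -/
theorem countable_of_countable_oneTypes {L : FirstOrder.Language.{v, w}} {M : Type u}
    [L.Structure M] [Nonempty M] {A : Set M} {ι : Type*} (φ : ι → ℕ → L[[A]].Formula (Fin 1))
    (hreal : ∀ i n, ∃ x : M, ∀ m ≤ n, (φ i m).Realize (fun _ => x))
    (hinc : ∀ i j, i ≠ j → ∃ n, ∀ x : M,
      ¬ ((φ i n).Realize (fun _ => x) ∧ (φ j n).Realize (fun _ => x)))
    [Countable (OneTypes L M A)] : Countable ι := by
  have hex : ∀ i, ∃ p : OneTypes L M A, ∀ n, Formula.equivSentence (φ i n) ∈ p := by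
    intro i
    let S : ℕ → (L[[A]])[[Fin 1]].Theory := fun n =>
      {θ | ∃ m ≤ n, θ = Formula.equivSentence (φ i m)}
    have hS : Monotone S := by
      rintro n n' h θ ⟨m, hm, e⟩
      exact ⟨m, hm.trans h, e⟩
    have hne : {p : OneTypes L M A | (⋃ n, S n) ⊆ (p : (L[[A]])[[Fin 1]].Theory)} ≠ ∅ := by
      rw [Ne, Theory.CompleteType.setOfPred_subset_eq_empty_iff, not_not, Set.union_iUnion,
        Theory.isSatisfiable_directed_union_iff (monotone_const.union hS).directed_le]
      intro n
      obtain ⟨x, hx⟩ := hreal i n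
      let q : OneTypes L M A := Theory.typeOf _ (fun _ => x)
      refine q.isMaximal.1.mono (Set.union_subset q.subset ?_)
      rintro _ ⟨m, hm, rfl⟩
      exact Theory.CompleteType.formula_mem_typeOf.2 (hx m hm)
    obtain ⟨p, hp⟩ := Set.nonempty_iff_ne_empty.2 hne
    exact ⟨p, fun n => hp (Set.mem_iUnion.2 ⟨n, n, le_rfl, rfl⟩)⟩
  choose p hp using hex
  refine Function.Injective.countable (f := p) fun i j hij => ?_
  by_contra hne
  obtain ⟨n, hn⟩ := hinc i j hne
  obtain ⟨N, v, hv⟩ := Theory.exists_modelType_is_realized_in _ (p i)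
  have h1 := hp i n
  have h2 := hp j n
  rw [← hij, ← hv] at h2
  rw [← hv] at h1
  rw [Theory.CompleteType.formula_mem_typeOf] at h1 h2
  -- The type may be realized only in another model `N`; an existential sentence carries the clash
  -- back to `M`.
  let σ : L[[A]].Sentence :=
    Formula.iExs (Fin 1) ((φ i n ⊓ φ j n).relabel (Sum.inr : Fin 1 → Empty ⊕ Fin 1))
  have key : ∀ (K : Type _) [L[[A]].Structure K], K ⊨ σ ↔
      ∃ w : Fin 1 → K, (φ i n).Realize w ∧ (φ j n).Realize w := by
    intro K _
    simp only [σ, Sentence.Realize, Formula.realize_iExs, Formula.realize_relabel,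
      Formula.realize_inf]
    rfl
  have keyM : M ⊨ σ ↔ ∃ w : Fin 1 → M, (φ i n).Realize w ∧ (φ j n).Realize w := by
    simp only [σ, Sentence.Realize, Formula.realize_iExs, Formula.realize_relabel,
      Formula.realize_inf]
    rfl
  have hN : N ⊨ σ := (key N).2 ⟨v, h1, h2⟩
  obtain ⟨w, hw⟩ := keyM.1 <|
    ((realize_iff_of_model_completeTheory (L := L[[A]]) M N σ).1 hN)
  have hw0 : w = fun _ => w 0 := funext fun k => by rw [Subsingleton.elim k 0]
  rw [hw0] at hw
  exact hn _ hw

/-! ### Definability of the sets `g ^ a * C(g) ^ k` -/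

namespace groupLanguage
open FirstOrder Language
variable {α : Type*} {G : Type*} [Group G]

/-- The product of two terms. -/
def mulTerm (s t : groupLanguage.Term α) : groupLanguage.Term α :=
  Term.func (GroupFunc.mul : groupLanguage.Functions 2) ![s, t]

/-- The power of a term. -/
def powTerm (t : groupLanguage.Term α) : ℕ → groupLanguage.Term α
  | 0 => Term.func (GroupFunc.one : groupLanguage.Functions 0) ![]
  | n + 1 => mulTerm (powTerm t n) t

@[simp]
theorem realize_mulTerm (s t : groupLanguage.Term α) (v : α → G) :
    (mulTerm s t).realize v = s.realize v * t.realize v := rfl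

@[simp]
theorem realize_powTerm (t : groupLanguage.Term α) (n : ℕ) (v : α → G) :
    (powTerm t n).realize v = t.realize v ^ n := by
  induction n with
  | zero => rw [pow_zero]; rfl
  | succ n ih => rw [powTerm, realize_mulTerm, ih, pow_succ]

/-- The formula saying that `x` lies in `g ^ a * C(g) ^ k`. -/
theorem exists_formula_pow_mul_centralizer_pow (g : G) (a k : ℕ) :
    ∃ φ : groupLanguage[[({g} : Set G)]].Formula (Fin 1), ∀ x : G,
      φ.Realize (fun _ => x) ↔ ∃ y, Commute y g ∧ x = g ^ a * y ^ k := by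
  let vg : groupLanguage.Term ((({g} : Set G) ⊕ Fin 1) ⊕ Unit) :=
    Term.var (Sum.inl (Sum.inl ⟨g, rfl⟩))
  let vx : groupLanguage.Term ((({g} : Set G) ⊕ Fin 1) ⊕ Unit) := Term.var (Sum.inl (Sum.inr 0))
  let vy : groupLanguage.Term ((({g} : Set G) ⊕ Fin 1) ⊕ Unit) := Term.var (Sum.inr ())
  let ψ : groupLanguage.Formula (({g} : Set G) ⊕ Fin 1) := Formula.iExs Unit
    (Term.equal (mulTerm vy vg) (mulTerm vg vy) ⊓
      Term.equal vx (mulTerm (powTerm vg a) (powTerm vy k)))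
  refine ⟨BoundedFormula.constantsVarsEquiv.symm ψ, fun x => ?_⟩
  rw [Formula.Realize, ← BoundedFormula.realize_constantsVarsEquiv, Equiv.apply_symm_apply,
    ← Formula.Realize, Formula.realize_iExs]
  simp only [Formula.realize_inf, Formula.realize_equal, realize_mulTerm, realize_powTerm]
  constructor
  · rintro ⟨i, h⟩
    exact ⟨i (), h⟩
  · rintro ⟨y, h⟩
    exact ⟨fun _ => y, h⟩

end groupLanguage

/-! ### 2-adic digits and the criterion for failure of ω-stability -/

/-- The truncations of the 2-adic integer with digits `s`. -/
def digitSum (s : ℕ → Bool) (n : ℕ) : ℕ := ∑ i ∈ Finset.range n, if s i then 2 ^ i else 0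

theorem exists_digitSum_add (s : ℕ → Bool) {m n : ℕ} (h : m ≤ n) :
    ∃ k, digitSum s n = digitSum s m + k * 2 ^ m := by
  induction n, h using Nat.le_induction with
  | base => exact ⟨0, by simp⟩
  | succ n hmn ih =>
    obtain ⟨k, hk⟩ := ih
    obtain ⟨d, rfl⟩ := Nat.exists_eq_add_of_le hmn
    refine ⟨k + if s (m + d) then 2 ^ d else 0, ?_⟩
    rw [digitSum, Finset.sum_range_succ, ← digitSum, hk]
    split_ifs <;> ring

theorem exists_digitSum_not_dvd {s t : ℕ → Bool} (h : s ≠ t) :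
    ∃ n, ¬ (2 ^ n : ℤ) ∣ (digitSum s n : ℤ) - digitSum t n := by
  classical
  have hex : ∃ k, s k ≠ t k := Function.ne_iff.1 h
  obtain ⟨k, hk, hmin⟩ : ∃ k, s k ≠ t k ∧ ∀ m < k, s m = t m :=
    ⟨Nat.find hex, Nat.find_spec hex, fun m hm => not_not.1 (Nat.find_min hex hm)⟩
  have heq : digitSum s k = digitSum t k :=
    Finset.sum_congr rfl fun i hi => by rw [hmin i (Finset.mem_range.1 hi)]
  -- Up to the first differing digit `k` the sums agree, so the truncations at `k + 1` differ by `±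
  -- 2 ^ k`.
  refine ⟨k + 1, fun hd => ?_⟩
  rw [digitSum, digitSum, Finset.sum_range_succ, Finset.sum_range_succ, ← digitSum, ← digitSum,
    heq] at hd
  have h2 : (2 ^ (k + 1) : ℤ) ∣ 2 ^ k := by
    cases hs : s k <;> cases ht : t k <;> simp_all
  have := Int.le_of_dvd (by positivity) h2
  rw [pow_succ] at this
  have : (0 : ℤ) < 2 ^ k := by positivity
  omega

theorem not_omegaStableGroup_of_commute {G : Type u} [Group G] (g : G)
    (hg : ∀ (n a b : ℕ) (y z : G), Commute y g → Commute z g →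
      g ^ a * y ^ 2 ^ n = g ^ b * z ^ 2 ^ n → (2 ^ n : ℤ) ∣ (a : ℤ) - b) :
    ¬ OmegaStableGroup G := by
  intro hG
  have hc : Countable (OneTypes groupLanguage G ({g} : Set G)) :=
    hG G {g} (Set.countable_singleton g)
  choose φ hφ using groupLanguage.exists_formula_pow_mul_centralizer_pow g
  have : Countable (ℕ → Bool) := by
    refine countable_of_countable_oneTypes (L := groupLanguage) (M := G) (A := {g})
      (fun s n => φ (digitSum s n) (2 ^ n)) (fun s n => ⟨g ^ digitSum s n, fun m hm => ?_⟩)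
      (fun s t hst => ?_)
    -- Digits from position `m` on contribute a `2 ^ m`-th power of a power of `g`.
    · obtain ⟨k, hk⟩ := exists_digitSum_add s hm
      exact (hφ _ _ _).2 ⟨g ^ k, Commute.pow_left rfl k, by rw [hk, pow_add, pow_mul]⟩
    · obtain ⟨n, hn⟩ := exists_digitSum_not_dvd hst
      refine ⟨n, fun x ⟨h1, h2⟩ => hn ?_⟩
      obtain ⟨y, hy, rfl⟩ := (hφ _ _ _).1 h1
      obtain ⟨z, hz, h⟩ := (hφ _ _ _).1 h2
      exact hg n _ _ y z hy hz h
  obtain ⟨f, hf⟩ := exists_surjective_nat (ℕ → Bool)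
  obtain ⟨n, hn⟩ := hf fun k => !(f k k)
  simpa using congrFun hn n

/-! ### Alternating words and centralizers in amalgamated products -/

section Amalgam

variable {G : Type u} [Group G] {A : Subgroup G} {H : Fin 2 → Subgroup G}

/-- `x` is a product of `n` letters, alternately from `H 0 \ A` and `H 1 \ A`, the first one from
`H i` and the last one from `H j`. -/
inductive IsAlternating (A : Subgroup G) (H : Fin 2 → Subgroup G) : Fin 2 → Fin 2 → ℕ → G → Prop
  | single {i : Fin 2} {x : G} (hx : x ∈ H i) (hxA : x ∉ A) : IsAlternating A H i i 1 x
  | cons {i k j : Fin 2} {n : ℕ} {x w : G} (hx : x ∈ H i) (hxA : x ∉ A) (hik : i ≠ k)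
      (hw : IsAlternating A H k j n w) : IsAlternating A H i j (n + 1) (x * w)

namespace IsAlternating

theorem mul {i j k l : Fin 2} {m n : ℕ} {x y : G} (hx : IsAlternating A H i j m x)
    (hy : IsAlternating A H k l n y) (hjk : j ≠ k) : IsAlternating A H i l (m + n) (x * y) := by
  induction hx with
  | single hx hxA => rw [add_comm]; exact cons hx hxA hjk hy
  | @cons i k' j n' x w hx hxA hik _ ih =>
    rw [mul_assoc, show n' + 1 + n = n' + n + 1 by omega]
    exact cons hx hxA hik (ih hjk)

theorem inv {i j : Fin 2} {n : ℕ} {x : G} (hx : IsAlternating A H i j n x) :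
    IsAlternating A H j i n x⁻¹ := by
  induction hx with
  | single hx hxA => exact single (inv_mem hx) (by simpa using hxA)
  | cons hx hxA hik _ ih =>
    rw [mul_inv_rev]
    exact ih.mul (single (inv_mem hx) (by simpa using hxA)) hik.symm

theorem base_mul (hA : ∀ i, A ≤ H i) {i j : Fin 2} {n : ℕ} {x a : G} (ha : a ∈ A)
    (hx : IsAlternating A H i j n x) : IsAlternating A H i j n (a * x) := by
  cases hx with
  | single hx hxA =>
    exact single (mul_mem (hA i ha) hx) (by rwa [A.mul_mem_cancel_left ha])
  | cons hx hxA hik hw =>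
    rw [← mul_assoc]
    exact cons (mul_mem (hA i ha) hx) (by rwa [A.mul_mem_cancel_left ha]) hik hw

theorem pos {i j : Fin 2} {n : ℕ} {x : G} (hx : IsAlternating A H i j n x) : 0 < n := by
  cases hx <;> omega

/-- Left multiplication by a letter of the initial subgroup either keeps the length, or merges the
first letter into the rest of the word. -/
theorem letter_mul (hA : ∀ i, A ≤ H i) {i j : Fin 2} {n : ℕ} {x y : G}
    (hx : IsAlternating A H i j n x) (hy : y ∈ H i) :
    IsAlternating A H i j n (y * x) ∨ (n = 1 ∧ i = j ∧ y * x ∈ A) ∨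
      ∃ k m, i ≠ k ∧ n = m + 1 ∧ IsAlternating A H k j m (y * x) := by
  cases hx with
  | single hx hxA =>
    by_cases h : y * x ∈ A
    · exact .inr (.inl ⟨rfl, rfl, h⟩)
    · exact .inl (single (mul_mem hy hx) h)
  | @cons _ k _ m x w hx hxA hik hw =>
    by_cases h : y * x ∈ A
    · exact .inr (.inr ⟨k, m, hik, rfl, by rw [← mul_assoc]; exact hw.base_mul hA h⟩)
    · exact .inl (by rw [← mul_assoc]; exact cons (mul_mem hy hx) h hik hw)

end IsAlternating

theorem mem_or_exists_isAlternating (hA : ∀ i, A ≤ H i)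
    (htop : ⨆ i, H i = ⊤) (x : G) : x ∈ A ∨ ∃ i j n, IsAlternating A H i j n x := by
  have hx : x ∈ ⨆ i, H i := htop ▸ Subgroup.mem_top x
  have step : ∀ (i : Fin 2) (y x : G), y ∈ H i →
      (x ∈ A ∨ ∃ i j n, IsAlternating A H i j n x) →
      (y * x ∈ A ∨ ∃ i j n, IsAlternating A H i j n (y * x)) := by
    rintro i y x hy (hx | ⟨k, j, n, hx⟩)
    · by_cases h : y * x ∈ A
      · exact .inl h
      · exact .inr ⟨_, _, _, .single (mul_mem hy (hA i hx)) h⟩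
    · by_cases hik : i = k
      · subst hik
        rcases hx.letter_mul hA hy with h | ⟨-, -, h⟩ | ⟨_, _, -, -, h⟩
        · exact .inr ⟨_, _, _, h⟩
        · exact .inl h
        · exact .inr ⟨_, _, _, h⟩
      · by_cases hyA : y ∈ A
        · exact .inr ⟨_, _, _, hx.base_mul hA hyA⟩
        · exact .inr ⟨_, _, _, .cons hy hyA hik hx⟩
  -- With `z` arbitrary, the property of `x` is closed under products.
  have key : ∀ z, (z ∈ A ∨ ∃ i j n, IsAlternating A H i j n z) →
      (x * z ∈ A ∨ ∃ i j n, IsAlternating A H i j n (x * z)) := by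
    induction hx using Subgroup.iSup_induction' with
    | hp i y hy => exact fun z => step i y z hy
    | h1 => simp
    | hmul a b _ _ iha ihb => exact fun z hz => by rw [mul_assoc]; exact iha _ (ihb _ hz)
  simpa using key 1 (.inl A.one_mem)

open Monoid in
theorem IsAlternating.exists_word (hA : ∀ i, A ≤ H i)
    (e : PushoutI (fun i => Subgroup.inclusion (hA i)) ≃* G)
    (he : ∀ (i : Fin 2) (x : H i), e (PushoutI.of i x) = (x : G))
    {i j : Fin 2} {n : ℕ} {x : G} (hx : IsAlternating A H i j n x) :
    ∃ w : CoprodI.Word (fun i => H i),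
      PushoutI.Reduced (fun i => Subgroup.inclusion (hA i)) w ∧
      e (PushoutI.ofCoprodI w.prod) = x ∧ w.toList.length = n ∧ w.fstIdx = some i := by
  have key : ∀ {i : Fin 2} {y : G} (hy : y ∈ H i), y ∉ A →
      ((⟨y, hy⟩ : H i) ∉ (Subgroup.inclusion (hA i)).range) ∧ (⟨y, hy⟩ : H i) ≠ 1 := by
    intro i y hy hyA
    refine ⟨?_, fun h => hyA ?_⟩
    · rintro ⟨a, ha⟩
      obtain rfl : (a : G) = y := congrArg Subtype.val ha
      exact hyA a.2
    · rw [show y = 1 from congrArg Subtype.val h]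
      exact A.one_mem
  induction hx with
  | @single i y hy hyA =>
    obtain ⟨h1, h2⟩ := key hy hyA
    have hf : (CoprodI.Word.empty : CoprodI.Word fun i => H i).fstIdx ≠ some i := by
      simp [CoprodI.Word.fstIdx, CoprodI.Word.empty]
    refine ⟨CoprodI.Word.cons ⟨y, hy⟩ .empty hf h2, ?_, ?_, ?_, ?_⟩
    · intro l hl
      obtain rfl : l = ⟨i, y, hy⟩ := by simpa [CoprodI.Word.cons, CoprodI.Word.empty] using hl
      exact h1
    · rw [CoprodI.Word.prod_cons]; simp [he]
    · simp [CoprodI.Word.cons, CoprodI.Word.empty]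
    · simp [CoprodI.Word.fstIdx, CoprodI.Word.cons]
  | @cons i k j n y z hy hyA hik _ ih =>
    obtain ⟨h1, h2⟩ := key hy hyA
    obtain ⟨w, hw, hp, hl, hf⟩ := ih
    refine ⟨CoprodI.Word.cons ⟨y, hy⟩ w (by rw [hf]; simpa using hik.symm) h2, ?_, ?_, ?_, ?_⟩
    · intro l hl
      rcases List.mem_cons.1 hl with rfl | hl
      · exact h1
      · exact hw l hl
    · simp [he, hp]
    · simp [CoprodI.Word.cons, hl]
    · simp [CoprodI.Word.fstIdx, CoprodI.Word.cons]

-- Passing from a reduced word to the normal word of its element preserves the sequence of factors,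
-- hence the length.
open Monoid in
theorem IsAlternating.length_unique (hA : ∀ i, A ≤ H i)
    (e : PushoutI (fun i => Subgroup.inclusion (hA i)) ≃* G)
    (he : ∀ (i : Fin 2) (x : H i), e (PushoutI.of i x) = (x : G))
    {i j i' j' : Fin 2} {n n' : ℕ} {x : G} (hx : IsAlternating A H i j n x)
    (hx' : IsAlternating A H i' j' n' x) : n = n' := by
  obtain ⟨w, hw, hp, rfl, -⟩ := hx.exists_word hA e he
  obtain ⟨w', hw', hp', rfl, -⟩ := hx'.exists_word hA e he
  obtain ⟨d⟩ := PushoutI.NormalWord.transversal_nonempty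
    (fun i => Subgroup.inclusion (hA i)) fun i => Subgroup.inclusion_injective (hA i)
  obtain ⟨v, hv, hm⟩ := hw.exists_normalWord_prod_eq d
  obtain ⟨v', hv', hm'⟩ := hw'.exists_normalWord_prod_eq d
  have : v = v' := PushoutI.NormalWord.prod_injective <| by
    rw [hv, hv']
    exact e.injective (hp.trans hp'.symm)
  subst this
  simpa using congrArg List.length (hm.symm.trans hm')

open Monoid in
theorem IsAlternating.not_mem (hA : ∀ i, A ≤ H i)
    (e : PushoutI (fun i => Subgroup.inclusion (hA i)) ≃* G)
    (he : ∀ (i : Fin 2) (x : H i), e (PushoutI.of i x) = (x : G))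
    {i j : Fin 2} {n : ℕ} {x : G} (hx : IsAlternating A H i j n x) : x ∉ A := by
  intro hxA
  obtain ⟨w, hw, hp, hl, -⟩ := hx.exists_word hA e he
  have := hw.eq_empty_of_mem_range (fun i => Subgroup.inclusion_injective (hA i))
    ⟨⟨x, hxA⟩, e.injective <| by
      rw [hp, ← PushoutI.of_apply_eq_base (fun i => Subgroup.inclusion (hA i)) 0, he]; rfl⟩
  have hpos := hx.pos
  rw [this] at hl
  simp [CoprodI.Word.empty] at hl
  omega

/-- The last letter of `c` and `x` share a factor, so they merge and the length stays below `n + 2`.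
Inverting reduces this to `letter_mul`. -/
theorem IsAlternating.mul_letter_mul_letter (hA : ∀ i, A ≤ H i) {i j : Fin 2} {n : ℕ} {c x y : G}
    (hc : IsAlternating A H i j n c) (hx : x ∈ H j) {k : Fin 2} (hjk : j ≠ k) (hy : y ∈ H k)
    (hyA : y ∉ A) :
    c * (x * y) ∈ A ∨ ∃ i' j' m, m ≤ n + 1 ∧ IsAlternating A H i' j' m (c * (x * y)) := by
  have hy' : IsAlternating A H k k 1 y⁻¹ := .single (inv_mem hy) (by simpa using hyA)
  suffices y⁻¹ * (x⁻¹ * c⁻¹) ∈ A ∨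
      ∃ i' j' m, m ≤ n + 1 ∧ IsAlternating A H i' j' m (y⁻¹ * (x⁻¹ * c⁻¹)) by
    rcases this with h | ⟨i', j', m, hm, h⟩
    · exact .inl (by simpa [mul_assoc] using inv_mem h)
    · exact .inr ⟨j', i', m, hm, by simpa [mul_assoc] using h.inv⟩
  rcases hc.inv.letter_mul hA (inv_mem hx) with h | ⟨-, -, h⟩ | ⟨l, m, hl, rfl, h⟩
  · exact .inr ⟨_, _, _, by omega, hy'.mul h hjk.symm⟩
  · refine .inr ⟨k, k, 1, by omega, ?_⟩
    exact .single (mul_mem (inv_mem hy) (hA k h)) (by rw [A.mul_mem_cancel_right h]; simpa using hyA)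
  · obtain rfl : l = k := by omega
    rcases h.letter_mul hA (inv_mem hy) with h | ⟨-, -, h⟩ | ⟨l, m', -, hm, h⟩
    · exact .inr ⟨_, _, m, by omega, h⟩
    · exact .inl h
    · exact .inr ⟨_, _, m', by omega, h⟩

/-- The centralizer of `x * y`, where `x ∈ H 0 \ A` and `y ∈ H 1 \ A`. -/
theorem exists_zpow_mul_mem_of_commute (hA : ∀ i, A ≤ H i)
    (e : Monoid.PushoutI (fun i => Subgroup.inclusion (hA i)) ≃* G)
    (he : ∀ (i : Fin 2) (x : H i), e (Monoid.PushoutI.of i x) = (x : G)) (htop : ⨆ i, H i = ⊤)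
    {x y : G} (hx : x ∈ H 0) (hxA : x ∉ A) (hy : y ∈ H 1) (hyA : y ∉ A) {c : G}
    (hc : Commute c (x * y)) : ∃ k : ℤ, ∃ a ∈ A, c = (x * y) ^ k * a := by
  have hX : IsAlternating A H 0 0 1 x := .single hx hxA
  have hY : IsAlternating A H 1 1 1 y := .single hy hyA
  have hg : IsAlternating A H 0 1 2 (x * y) := hX.mul hY (by decide)
  -- `(x * y) * c` is reduced of length `n + 2`, but `c * (x * y)` is shorter because `x` merges.
  have h00 : ∀ {n c}, Commute c (x * y) → ¬ IsAlternating A H 0 0 n c := by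
    intro n c hc h
    have hl := (hg.mul h (by decide))
    rw [← hc.eq] at hl
    rcases h.mul_letter_mul_letter hA hx (by decide) hy hyA with h' | ⟨_, _, m, hm, h'⟩
    · exact hl.not_mem hA e he h'
    · have := hl.length_unique hA e he h'
      omega
  have h11 : ∀ {n c}, Commute c (x * y) → ¬ IsAlternating A H 1 1 n c := by
    intro n c hc h
    have hl := (h.mul hg (by decide)).inv
    rw [hc.eq] at hl
    rcases h.inv.mul_letter_mul_letter hA (inv_mem hy) (by decide) (inv_mem hx)
      (by simpa using hxA) with h' | ⟨_, _, m, hm, h'⟩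
    · exact hl.not_mem hA e he (by simpa [mul_assoc] using h')
    · have := hl.length_unique hA e he (by simpa [mul_assoc] using h')
      omega
  -- Descent on length: unless both `x⁻¹` and `y⁻¹` are absorbed, `(x * y)⁻¹ * c` begins and ends in
  -- `H 1`, against `h11`.
  have h01 : ∀ n c, Commute c (x * y) → IsAlternating A H 0 1 n c →
      ∃ k : ℤ, ∃ a ∈ A, c = (x * y) ^ k * a := by
    intro n
    induction n using Nat.strong_induction_on with
    | _ n ih =>
      intro c hc h
      have hc' : Commute ((x * y)⁻¹ * c) (x * y) := (Commute.refl (x * y)).inv_left.mul_left hc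
      have hassoc : (x * y)⁻¹ * c = y⁻¹ * (x⁻¹ * c) := by group
      suffices ∃ k : ℤ, ∃ a ∈ A, (x * y)⁻¹ * c = (x * y) ^ k * a by
        obtain ⟨k, a, ha, hk⟩ := this
        exact ⟨1 + k, a, ha, by rw [zpow_add, mul_assoc, ← hk]; group⟩
      rcases h.letter_mul hA (inv_mem hx) with h | ⟨-, h, -⟩ | ⟨l, m, hl, rfl, h⟩
      · exact absurd (hassoc ▸ hY.inv.mul h (by decide)) (h11 hc')
      · exact absurd h (by decide)
      · obtain rfl : l = 1 := by omega
        rcases h.letter_mul hA (inv_mem hy) with h | ⟨-, -, h⟩ | ⟨l, m, hl, rfl, h⟩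
        · exact absurd (hassoc ▸ h) (h11 hc')
        · exact ⟨0, _, h, by rw [zpow_zero, one_mul, hassoc]⟩
        · obtain rfl : l = 0 := by omega
          exact ih m (by omega) _ hc' (hassoc ▸ h)
  rcases mem_or_exists_isAlternating hA htop c with h | ⟨i, j, n, h⟩
  · exact ⟨0, c, h, by simp⟩
  · match i, j, h with
    | 0, 0, h => exact absurd h (h00 hc)
    | 1, 1, h => exact absurd h (h11 hc)
    | 0, 1, h => exact h01 n c hc h
    | 1, 0, h =>
      obtain ⟨k, a, ha, hk⟩ := h01 n c⁻¹ hc.inv_left h.inv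
      have hca : Commute a (x * y) := by
        rw [show a = ((x * y) ^ k)⁻¹ * c⁻¹ by rw [hk]; group]
        exact ((Commute.refl (x * y)).zpow_left k).inv_left.mul_left hc.inv_left
      refine ⟨-k, a⁻¹, inv_mem ha, ?_⟩
      rw [← inv_inv c, hk, mul_inv_rev, zpow_neg]
      exact (hca.inv_left.zpow_right k).inv_right.eq

theorem eq_zero_of_zpow_mem (hA : ∀ i, A ≤ H i)
    (e : Monoid.PushoutI (fun i => Subgroup.inclusion (hA i)) ≃* G)
    (he : ∀ (i : Fin 2) (x : H i), e (Monoid.PushoutI.of i x) = (x : G))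
    {x y : G} (hx : x ∈ H 0) (hxA : x ∉ A) (hy : y ∈ H 1) (hyA : y ∉ A) {k : ℤ}
    (hk : (x * y) ^ k ∈ A) : k = 0 := by
  have hg : IsAlternating A H 0 1 2 (x * y) := .cons hx hxA (by decide) (.single hy hyA)
  have hpow : ∀ n : ℕ, ∃ m, IsAlternating A H 0 1 m ((x * y) ^ (n + 1)) := by
    intro n
    induction n with
    | zero => exact ⟨2, by simpa using hg⟩
    | succ n ih =>
      obtain ⟨m, hm⟩ := ih
      exact ⟨_, pow_succ (x * y) (n + 1) ▸ hm.mul hg (by decide)⟩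
  have hnat : ∀ n : ℕ, (x * y) ^ n ∈ A → n = 0 := by
    rintro (_ | n) h
    · rfl
    · obtain ⟨m, hm⟩ := hpow n
      exact absurd h (hm.not_mem hA e he)
  obtain ⟨n, rfl | rfl⟩ := k.eq_nat_or_neg
  · simpa using hnat n (by simpa using hk)
  · simpa using hnat n (by simpa using hk)

theorem iSup_eq_top_of_pushoutI_equiv (hA : ∀ i, A ≤ H i)
    (e : Monoid.PushoutI (fun i => Subgroup.inclusion (hA i)) ≃* G)
    (he : ∀ (i : Fin 2) (x : H i), e (Monoid.PushoutI.of i x) = (x : G)) : ⨆ i, H i = ⊤ := by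
  rw [eq_top_iff]
  intro g _
  obtain ⟨p, rfl⟩ := e.surjective g
  have hof : ∀ (i : Fin 2) (x : H i), e (Monoid.PushoutI.of i x) ∈ ⨆ i, H i := fun i x => by
    rw [he]
    exact Subgroup.mem_iSup_of_mem i x.2
  induction p using Monoid.PushoutI.induction_on with
  | of i x => exact hof i x
  | base a =>
    rw [← Monoid.PushoutI.of_apply_eq_base (fun i => Subgroup.inclusion (hA i)) 0]
    exact hof _ _
  | mul p q hp hq =>
    rw [map_mul]
    exact mul_mem (hp trivial) (hq trivial)

end Amalgam

/-! ### The two kinds of splitting -/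

theorem IsNontrivialAmalgamOver.not_omegaStableGroup {G : Type u} [Group G] {A : Subgroup G}
    (h : IsNontrivialAmalgamOver A) : ¬ OmegaStableGroup G := by
  obtain ⟨H, hlt, e, he⟩ := h
  have hA : ∀ i, A ≤ H i := fun i => (hlt i).le
  obtain ⟨x, hx, hxA⟩ := SetLike.exists_of_lt (hlt 0)
  obtain ⟨y, hy, hyA⟩ := SetLike.exists_of_lt (hlt 1)
  have hcent : ∀ c : G, Commute c (x * y) →
      ∃ k : ℤ, ∃ a ∈ A, Commute a (x * y) ∧ c = (x * y) ^ k * a := by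
    intro c hc
    obtain ⟨k, a, ha, rfl⟩ := exists_zpow_mul_mem_of_commute hA e he
      (iSup_eq_top_of_pushoutI_equiv hA e he) hx hxA hy hyA hc
    refine ⟨k, a, ha, ?_, rfl⟩
    simpa using ((Commute.refl (x * y)).zpow_left k).inv_left.mul_left hc
  refine not_omegaStableGroup_of_commute (x * y) fun n a b c d hc hd heq => ?_
  obtain ⟨k, s, hs, hsc, rfl⟩ := hcent c hc
  obtain ⟨l, t, ht, htc, rfl⟩ := hcent d hd
  generalize hg : x * y = g at *
  rw [(hsc.symm.zpow_left k).mul_pow, (htc.symm.zpow_left l).mul_pow, ← mul_assoc,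
    ← mul_assoc, ← zpow_natCast g a, ← zpow_natCast g b, ← zpow_natCast (g ^ k),
    ← zpow_natCast (g ^ l), ← zpow_mul, ← zpow_mul, ← zpow_add, ← zpow_add] at heq
  -- Once the powers of `g` are collected, what remains is a product of elements of `A`.
  have hmem : g ^ ((a + k * (2 ^ n : ℕ)) - (b + l * (2 ^ n : ℕ)) : ℤ) ∈ A := by
    have h2 : g ^ ((a + k * (2 ^ n : ℕ)) - (b + l * (2 ^ n : ℕ)) : ℤ) =
        t ^ 2 ^ n * (s ^ 2 ^ n)⁻¹ := by
      rw [sub_eq_neg_add, zpow_add, zpow_neg, eq_mul_inv_of_mul_eq heq, mul_assoc,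
        inv_mul_cancel_left]
    rw [h2]
    exact mul_mem (pow_mem ht _) (inv_mem (pow_mem hs _))
  subst hg
  have h0 := eq_zero_of_zpow_mem hA e he hx hxA hy hyA hmem
  push_cast at h0
  exact ⟨l - k, by linear_combination h0⟩

theorem IsHNNExtensionOver.not_omegaStableGroup {G : Type u} [Group G] {A : Subgroup G}
    (h : IsHNNExtensionOver A) : ¬ OmegaStableGroup G := by
  obtain ⟨K, -, B, φ, e, -⟩ := h
  -- Exponent sum of `t`: trivial on `K`, so it respects the defining relations.
  let χ : G →* Multiplicative ℤ :=
    (HNNExtension.lift 1 (Multiplicative.ofAdd 1) (by simp)).comp e.symm.toMonoidHom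
  have hχ : χ (e HNNExtension.t) = Multiplicative.ofAdd 1 := by simp [χ]
  refine not_omegaStableGroup_of_commute (e HNNExtension.t) fun n a b y z _ _ h => ?_
  have h' := congrArg (fun g => Multiplicative.toAdd (χ g)) h
  simp only [map_mul, map_pow, hχ, toAdd_mul, toAdd_pow, toAdd_ofAdd, nsmul_eq_mul, mul_one] at h'
  push_cast at h'
  exact ⟨Multiplicative.toAdd (χ z) - Multiplicative.toAdd (χ y), by linear_combination h'⟩

theorem corollary1 {G : Type u} [Group G] (A : Subgroup G) (h : SplitsOver A) :
    ¬ OmegaStableGroup G :=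
  h.elim (·.not_omegaStableGroup) (·.not_omegaStableGroup)
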